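/- Let $m\ge 2$ and let $p=(p_0,\dots,p_m)$ be a probability vector ($p_j\ge 0$, $\sum_{j=0}^m p_j=1$) with $p_0>0$, $p_1=0$ and $\sum_{j=0}^m(1-j)p_j=0$. Define polynomials by $P_k(z)=z^k$ for $0\le k\le m-1$ and $$P_{k+1}(z)=\frac{z-p_1}{p_0}P_k(z)-\sum_{j=2}^m\frac{p_j}{p_0}P_{k+1-j}(z)\qquad (k\ge m-1).$$ Let $\gamma$ be the closed curve $z(t)=\sum_{j=0}^m p_j e^{i(1-j)t}$, $t\in[0,2\pi]$, and let $\Gamma$ be the closure of the region enclosed by $\gamma$, that is, the closure of the union of $\gamma$ and the bounded connected components of $\mathbb C\setminus\gamma$. Let $Y_0,Y_1,Y_2,\dots$ be the Markov chain on $\mathbb Z$ with $Y_0=0$ and the following transition probabilities. - From $k\in\{0,\dots,m-2\}$ it moves to $k+1$ with probability $\frac{2k+1}{2k+2}$ and to $-(k+1)$ with probability $\frac1{2k+2}$. - From $k\ge m-1$ it moves to $k+1-j$ with probability $p_j$, for $j=0,\dots,m$. - From $k<0$ it moves to $j$ with the probability with which it moves from $-k$ to $-j$, for $j\in\mathbb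 Z$. **Theorem 1.4 (approximation of $z^n$ by a polynomial of degree $\sim\sqrt n$).** There are constants $C,c>0$ depending only on $p$ such that for all integers $n\ge 0$ and all real $t\ge 0$, with $\alpha_k=\mathbb P(|Y_n|=k)$, the polynomial $\sum_{k=0}^{\lfloor t\sqrt n\rfloor}\alpha_kP_k$ has degree at most $\lfloor t\sqrt n\rfloor$ and $$\left|\sum_{k=0}^{\lfloor t\sqrt n\rfloor}\alpha_kP_k(z)-z^n\right|\le C e^{-ct^2}\qquad\text{for all } z\in\Gamma .$$ -/

import Mathlib

open MeasureTheory ProbabilityTheory Polynomial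

noncomputable section

namespace WalkPoly

/-- `p = (p₀, …, p_m)` is a probability vector with `p₀ > 0`, `∑ (1 - j) p_j = 0` and `p₁ = 0`.
(These conditions force `m ≥ 2`.) -/
structure IsAdmissible {m : ℕ} (p : Fin (m + 1) → ℝ) : Prop where
  nonneg : ∀ j, 0 ≤ p j
  sum_eq_one : ∑ j, p j = 1
  zero_pos : 0 < p 0
  mean_zero : ∑ j : Fin (m + 1), (1 - (j : ℝ)) * p j = 0
  one_eq_zero : ∀ j : Fin (m + 1), (j : ℕ) = 1 → p j = 0

/-- The polynomials `P_k`: `P_k = z ^ k` for `k < m`, and for `k ≥ m - 1`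
`P_{k+1} = (z - p₁) / p₀ * P_k - ∑_{2 ≤ j ≤ m} (p_j / p₀) * P_{k+1-j}`. -/
def P {m : ℕ} (p : Fin (m + 1) → ℝ) : ℕ → ℂ[X]
  | 0 => 1
  | k + 1 =>
    if k + 1 < m then X ^ (k + 1)
    else
      C ((p 0 : ℂ)⁻¹) * (X - C (p 1 : ℂ)) * P p k
        - ∑ j : Fin (m + 1),
            if 2 ≤ (j : ℕ) then C ((p j : ℂ) / (p 0 : ℂ)) * P p (k + 1 - (j : ℕ)) else 0

/-- The parametrization `z(t) = ∑ p_j e^{i (1 - j) t}`. -/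
def curve {m : ℕ} (p : Fin (m + 1) → ℝ) (t : ℝ) : ℂ :=
  ∑ j : Fin (m + 1), (p j : ℂ) * Complex.exp (Complex.I * ((1 - (j : ℂ)) * (t : ℂ)))

/-- The closed curve `γ`, as a subset of the plane. -/
def gammaCurve {m : ℕ} (p : Fin (m + 1) → ℝ) : Set ℂ :=
  curve p '' Set.Icc 0 (2 * Real.pi)

/-- The set `Γ`: the closure of the region enclosed by `γ`, where the region consists of the curve
itself together with the bounded connected components of its complement. -/
def region {m : ℕ} (p : Fin (m + 1) → ℝ) : Set ℂ :=
  closure (gammaCurve p ∪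
    {z | z ∈ (gammaCurve p)ᶜ ∧ Bornology.IsBounded (connectedComponentIn (gammaCurve p)ᶜ z)})

/-- The law of the index `j` with `ℙ(j) = p_j`. -/
def indexLaw {m : ℕ} (p : Fin (m + 1) → ℝ) (hp : IsAdmissible p) : PMF (Fin (m + 1)) :=
  PMF.ofFintype (fun j => ENNReal.ofReal (p j)) (by
    rw [← ENNReal.ofReal_sum_of_nonneg fun j _ => hp.nonneg j, hp.sum_eq_one, ENNReal.ofReal_one])

/-- The law on `{true, false}` with weights `(2k+1)/(2k+2)` and `1/(2k+2)`. -/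
def flipLaw (k : ℕ) : PMF Bool :=
  PMF.ofFintype
    (fun b => if b then ENNReal.ofReal ((2 * (k : ℝ) + 1) / (2 * k + 2))
      else ENNReal.ofReal (1 / (2 * (k : ℝ) + 2))) (by
    have h : (2 * (k : ℝ) + 1) / (2 * k + 2) + 1 / (2 * (k : ℝ) + 2) = 1 := by
      field_simp
      ring
    simp only [Fintype.sum_bool, if_true, Bool.false_eq_true, if_false]
    rw [← ENNReal.ofReal_add (by positivity) (by positivity), h, ENNReal.ofReal_one])

/-- The one-step law of the walk from a state `k ≥ 0`. If `k ≤ m - 2`, it moves to `k + 1` with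
probability `(2k+1)/(2k+2)` and to `-(k+1)` with probability `1/(2k+2)`. If `k ≥ m - 1`, it moves
to `k + 1 - j` with probability `p_j`, for `j = 0, …, m`. -/
def stepNat {m : ℕ} (p : Fin (m + 1) → ℝ) (hp : IsAdmissible p) (k : ℕ) : PMF ℤ :=
  if k + 1 < m then (flipLaw k).map fun b => if b then (k : ℤ) + 1 else -((k : ℤ) + 1)
  else (indexLaw p hp).map fun j => (k : ℤ) + 1 - ((j : ℕ) : ℤ)

/-- The one-step law of the walk from a state `k ∈ ℤ`; from a negative state it is the reflection
of the law from `-k`. -/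
def step {m : ℕ} (p : Fin (m + 1) → ℝ) (hp : IsAdmissible p) (k : ℤ) : PMF ℤ :=
  if 0 ≤ k then stepNat p hp k.toNat else (stepNat p hp (-k).toNat).map fun i => -i

/-- The Markov transition kernel of the walk. -/
def stepKernel {m : ℕ} (p : Fin (m + 1) → ℝ) (hp : IsAdmissible p) : Kernel ℤ ℤ :=
  Kernel.ofFunOfCountable fun k => (step p hp k).toMeasure

instance {m : ℕ} (p : Fin (m + 1) → ℝ) (hp : IsAdmissible p) :
    IsMarkovKernel (stepKernel p hp) :=
  ⟨fun k => PMF.toMeasure.isProbabilityMeasure (step p hp k)⟩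

/-- The transition at time `n` given the past up to time `n`: it depends on the last state only. -/
def pastKernel {m : ℕ} (p : Fin (m + 1) → ℝ) (hp : IsAdmissible p) (n : ℕ) :
    Kernel (Finset.Iic n → ℤ) ℤ :=
  (stepKernel p hp).comap (fun x => x ⟨n, Finset.mem_Iic.2 le_rfl⟩) (measurable_pi_apply _)

instance {m : ℕ} (p : Fin (m + 1) → ℝ) (hp : IsAdmissible p) (n : ℕ) :
    IsMarkovKernel (pastKernel p hp n) :=
  Kernel.IsMarkovKernel.comap _ _

/-- The probability measure on the path space `ℕ → ℤ` under which the coordinates form the Markov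
chain started at `0` with the transition law `step`. -/
def walkMeasure {m : ℕ} (p : Fin (m + 1) → ℝ) (hp : IsAdmissible p) : Measure (ℕ → ℤ) :=
  Kernel.trajMeasure (X := fun _ => ℤ) (Measure.dirac (0 : ℤ)) (pastKernel p hp)

/-- The walk: `Y n` is the position at time `n`. -/
def Y (n : ℕ) (ω : ℕ → ℤ) : ℤ := ω n

/-- `α_k = ℙ(|Y_n| = k)`. -/
def alpha {m : ℕ} (p : Fin (m + 1) → ℝ) (hp : IsAdmissible p) (n k : ℕ) : ℝ :=
  (walkMeasure p hp).real {ω | |Y n ω| = (k : ℤ)}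

/-- The polynomial `∑_{k ≤ ⌊t √n⌋} α_k P_k`. -/
def approx {m : ℕ} (p : Fin (m + 1) → ℝ) (hp : IsAdmissible p) (n : ℕ) (t : ℝ) : ℂ[X] :=
  ∑ k ∈ Finset.range (⌊t * Real.sqrt n⌋₊ + 1), C (alpha p hp n k : ℂ) * P p k

end WalkPoly

end

/-!
The function `k ↦ P_{|k|}(z)` on `ℤ` is an eigenfunction of the walk with eigenvalue `z`
(`WalkPoly.integral_step_eval_P`): this is the recurrence defining `P_k`. Hence
`z ^ n = 𝔼 P_{|Y_n|}(z)`, and the truncated sum differs from `z ^ n` by at most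
`sup_k |P_k(z)| * ℙ(|Y_n| > ⌊t √n⌋)`.

The walk is a martingale with increments bounded by `2 m`, so Hoeffding's lemma and the Chernoff
bound control the probability (`WalkPoly.measureReal_abs_Y_ge_le`). It remains to bound `P_k` on `Γ`
uniformly in `k`, and by the maximum principle (`WalkPoly.norm_eval_le_of_mem_region`) it suffices
to do so on `γ`.

For `z = z(t)` put `u = e^{-it}` and `S_k = u ^ k P_k(z)`. Since `u z = ∑ p_j u ^ j`, the recurrence
becomes `p₀ (S_{k+1} - S_k) = ∑_{j ≥ 2} p_j u ^ j (S_k - S_{k+1-j})`. As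
`∑_{j ≥ 2} (j - 1) p_j = p₀`, increments of `S` never exceed the initial ones, which are at most
`|u z - 1|`. Moreover `p₀ S_K - ∑_{j ≥ 2} p_j u ^ j ∑_{1 ≤ i < j} S_{K-i}` does not depend on `K`, and
it differs from `Q(u) S_K`, where `Q(u) = ∑_{j ≥ 2} (j - 1) p_j (1 - u ^ j)`, by a multiple of
`|u z - 1|`. So `S_K` is bounded as soon as `|u z - 1| ≤ C |Q(u)|` on the unit circle. This holds by
compactness: the zeros of `Q` on the circle are simple and are zeros of
`u z - 1 = ∑_{j ≥ 2} p_j (u ^ j - 1)` (`WalkPoly.exists_norm_sum_pow_sub_one_le`).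
-/

namespace WalkPoly

/-! ### Bounded solutions of the linear recurrence -/

/-- Backward differences of a solution of the recurrence stay bounded by any bound on the initial
ones: each new difference is a combination of earlier ones whose coefficients have absolute sum
`1`, because `S k - S (k - (j - 1))` telescopes into `j - 1` differences. -/
lemma norm_increment_le {m : ℕ} {q : Fin (m + 1) → ℝ} (hq : ∀ j, 0 ≤ q j) {p₀ : ℝ} (hp₀ : 0 < p₀)
    (hsum : ∑ j : Fin (m + 1), q j * ((j : ℕ) - 1 : ℕ) = p₀)
    {u : ℂ} (hu : ‖u‖ = 1) {S : ℕ → ℂ} {M : ℝ}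
    (hinit : ∀ k, k + 1 < m → ‖S (k + 1) - S k‖ ≤ M)
    (hrec : ∀ k, m ≤ k + 1 → (p₀ : ℂ) * (S (k + 1) - S k)
      = ∑ j : Fin (m + 1), (q j : ℂ) * u ^ (j : ℕ) * (S k - S (k - ((j : ℕ) - 1))))
    (k : ℕ) : ‖S (k + 1) - S k‖ ≤ M := by
  induction k using Nat.strong_induction_on with
  | _ k ih =>
    rcases lt_or_ge (k + 1) m with h | h
    · exact hinit k h
    have hback : ∀ r, r ≤ k → ‖S k - S (k - r)‖ ≤ r * M := by
      intro r hr
      induction r with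
      | zero => simp
      | succ r ihr =>
        have h1 := ih (k - (r + 1)) (by omega)
        have h2 := ihr (by omega)
        rw [show k - (r + 1) + 1 = k - r by omega] at h1
        calc ‖S k - S (k - (r + 1))‖
            = ‖(S k - S (k - r)) + (S (k - r) - S (k - (r + 1)))‖ := by congr 1; ring
          _ ≤ r * M + M := (norm_add_le _ _).trans (add_le_add h2 h1)
          _ = _ := by push_cast; ring
    have h3 : p₀ * ‖S (k + 1) - S k‖ ≤ p₀ * M := by
      calc p₀ * ‖S (k + 1) - S k‖ = ‖(p₀ : ℂ) * (S (k + 1) - S k)‖ := by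
            rw [norm_mul, Complex.norm_real, Real.norm_of_nonneg hp₀.le]
        _ ≤ ∑ j : Fin (m + 1), q j * ((j : ℕ) - 1 : ℕ) * M := by
            rw [hrec k h]
            refine norm_sum_le_of_le _ fun j _ => ?_
            rw [norm_mul, norm_mul, norm_pow, hu, one_pow, mul_one, Complex.norm_real,
              Real.norm_of_nonneg (hq j), mul_assoc]
            exact mul_le_mul_of_nonneg_left (hback _ (by have := j.2; omega)) (hq j)
        _ = p₀ * M := by rw [← Finset.sum_mul, hsum]
    exact le_of_mul_le_mul_left h3 hp₀

lemma norm_sub_le_of_increment_le {S : ℕ → ℂ} {M : ℝ} (hS : ∀ k, ‖S (k + 1) - S k‖ ≤ M)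
    (k r : ℕ) : ‖S (k + r) - S k‖ ≤ r * M := by
  induction r with
  | zero => simp
  | succ r ih =>
    calc ‖S (k + (r + 1)) - S k‖ = ‖(S (k + r + 1) - S (k + r)) + (S (k + r) - S k)‖ := by
          rw [← add_assoc]; congr 1; ring
      _ ≤ M + r * M := (norm_add_le _ _).trans (add_le_add (hS _) ih)
      _ = _ := by push_cast; ring

/-- Summing the recurrence against its conserved quantity. The factor
`∑ j, q j * (j - 1) * (1 - u ^ j)` vanishes exactly where the recurrence has a double
characteristic root; the bound says that away from such points a solution with increments of
size `M` does not drift. -/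
lemma norm_mul_sub_le {m : ℕ} {q : Fin (m + 1) → ℝ} (hq : ∀ j, 0 ≤ q j) {p₀ : ℝ}
    (hsum : ∑ j : Fin (m + 1), q j * ((j : ℕ) - 1 : ℕ) = p₀)
    {u : ℂ} (hu : ‖u‖ = 1) {S : ℕ → ℂ} {M : ℝ} (hM : 0 ≤ M)
    (hS : ∀ k, ‖S (k + 1) - S k‖ ≤ M)
    (hrec : ∀ k, m ≤ k + 1 → (p₀ : ℂ) * (S (k + 1) - S k)
      = ∑ j : Fin (m + 1), (q j : ℂ) * u ^ (j : ℕ) * (S k - S (k - ((j : ℕ) - 1))))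
    (k : ℕ) (hk : m ≤ k + 1) :
    ‖∑ j : Fin (m + 1), (q j : ℂ) * ((j : ℕ) - 1 : ℕ) * (1 - u ^ (j : ℕ))‖ * ‖S k - S (m - 1)‖
      ≤ 2 * (p₀ * m * M) := by
  -- `E` is independent of `K ≥ m - 1`, and differs from `Q * S K` only by increments of `S`.
  set E : ℕ → ℂ := fun K => (p₀ : ℂ) * S K -
    ∑ j : Fin (m + 1), (q j : ℂ) * u ^ (j : ℕ) * ∑ i ∈ Finset.range ((j : ℕ) - 1), S (K - (i + 1))
    with hE
  set Q : ℂ := ∑ j : Fin (m + 1), (q j : ℂ) * ((j : ℕ) - 1 : ℕ) * (1 - u ^ (j : ℕ)) with hQ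
  have hstep : ∀ K, m ≤ K + 1 → E (K + 1) = E K := by
    intro K hK
    have h1 : E (K + 1) - E K = (p₀ : ℂ) * (S (K + 1) - S K) -
        ∑ j : Fin (m + 1), (q j : ℂ) * u ^ (j : ℕ) * (S K - S (K - ((j : ℕ) - 1))) := by
      simp only [hE]
      rw [sub_sub_sub_comm, ← mul_sub, ← Finset.sum_sub_distrib]
      congr 1
      refine Finset.sum_congr rfl fun j _ => ?_
      rw [← mul_sub, ← Finset.sum_sub_distrib]
      congr 1
      have := Finset.sum_range_sub' (fun i => S (K - i)) ((j : ℕ) - 1)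
      simp only [Nat.sub_zero] at this
      rw [← this]
      refine Finset.sum_congr rfl fun i _ => ?_
      rw [Nat.add_sub_add_right]
    rw [hrec K hK, sub_self] at h1
    exact sub_eq_zero.1 h1
  have hconst : ∀ r, E (m - 1 + r) = E (m - 1) := by
    intro r
    induction r with
    | zero => rfl
    | succ r ih => rw [← add_assoc, hstep _ (by omega), ih]
  have hclose : ∀ K, m ≤ K + 1 → ‖E K - Q * S K‖ ≤ p₀ * m * M := by
    intro K hK
    have h1 : E K - Q * S K = ∑ j : Fin (m + 1), (q j : ℂ) * u ^ (j : ℕ) *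
        ∑ i ∈ Finset.range ((j : ℕ) - 1), (S K - S (K - (i + 1))) := by
      simp only [hE, hQ]
      rw [← hsum]
      push_cast
      rw [Finset.sum_mul, Finset.sum_mul, ← Finset.sum_sub_distrib, ← Finset.sum_sub_distrib]
      refine Finset.sum_congr rfl fun j _ => ?_
      rw [Finset.sum_sub_distrib, Finset.sum_const, Finset.card_range, nsmul_eq_mul]
      ring
    rw [h1]
    have h2 : ∑ j : Fin (m + 1), q j * ((j : ℕ) - 1 : ℕ) * (m * M) = p₀ * m * M := by
      rw [← Finset.sum_mul, hsum]; ring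
    rw [← h2]
    refine norm_sum_le_of_le _ fun j _ => ?_
    rw [norm_mul, norm_mul, norm_pow, hu, one_pow, mul_one, Complex.norm_real,
      Real.norm_of_nonneg (hq j), mul_assoc]
    refine mul_le_mul_of_nonneg_left ?_ (hq j)
    refine (norm_sum_le_of_le (f := fun i => S K - S (K - (i + 1))) _
      (n := fun _ => m * M) fun i hi => ?_).trans ?_
    · have hj := j.2
      have hi' := Finset.mem_range.1 hi
      have h3 := norm_sub_le_of_increment_le hS (K - (i + 1)) (i + 1)
      rw [Nat.sub_add_cancel (by omega)] at h3
      refine h3.trans (mul_le_mul_of_nonneg_right ?_ hM)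
      exact_mod_cast (by omega : i + 1 ≤ m)
    · simp
  obtain ⟨r, rfl⟩ : ∃ r, k = m - 1 + r := ⟨k - (m - 1), by omega⟩
  have h1 := hclose _ hk
  have h2 := hclose (m - 1) (by omega)
  rw [hconst r] at h1
  rw [← norm_mul]
  calc ‖Q * (S (m - 1 + r) - S (m - 1))‖
      = ‖(E (m - 1) - Q * S (m - 1)) - (E (m - 1) - Q * S (m - 1 + r))‖ := by congr 1; ring
    _ ≤ p₀ * m * M + p₀ * m * M := (norm_sub_le _ _).trans (add_le_add h2 h1)
    _ = _ := by ring

/-- A differentiable function is dominated by a multiple of another one on a compact set if it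
vanishes at the zeros of the latter and these are simple. -/
lemma exists_norm_le_mul_norm_of_simple_zeros {K : Set ℂ} (hK : IsCompact K) {A Q : ℂ → ℂ}
    (hA : Differentiable ℂ A) (hQ : Differentiable ℂ Q)
    (hz : ∀ u ∈ K, Q u = 0 → A u = 0 ∧ deriv Q u ≠ 0) :
    ∃ C : ℝ, 0 ≤ C ∧ ∀ u ∈ K, ‖A u‖ ≤ C * ‖Q u‖ := by
  have hloc : ∀ u ∈ K, ∃ C : ℝ, ∀ᶠ v in nhds u, ‖A v‖ ≤ C * ‖Q v‖ := by
    intro u hu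
    suffices h : A =O[nhds u] Q from h.bound
    by_cases h0 : Q u = 0
    · obtain ⟨hA0, hQ'⟩ := hz u hu h0
      have h1 : A =O[nhds u] fun v => v - u := by
        simpa [hA0] using (hA u).hasFDerivAt.isBigO_sub
      have h2 := (HasDerivAtFilter.isTheta_sub (hQ u).hasDerivAt hQ').2
      have h3 : (fun v => v - u) =O[nhds u] Q := by
        have := h2.comp_tendsto (k := fun v : ℂ => (v, u)) (l' := nhds u) (by
          simpa using (Filter.tendsto_id (x := nhds u)).prodMk (Filter.tendsto_const_pure (b := u)))
        simpa [Function.comp_def, h0] using this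
      exact h1.trans h3
    · have hQ1 : (fun _ => (1 : ℂ)) =O[nhds u] Q := by
        have := (hQ u).continuousAt
        exact (Asymptotics.isBigO_const_left_iff_pos_le_norm one_ne_zero).2
          ⟨‖Q u‖ / 2, by positivity, by
            have h4 : ‖Q u‖ / 2 < ‖Q u‖ := half_lt_self (by positivity)
            filter_upwards [this.norm.eventually (lt_mem_nhds h4)] with v hv using hv.le⟩
      exact ((hA u).continuousAt.isBigO_one ℂ).trans hQ1
  choose! C hC using hloc
  obtain ⟨t, htK, hcover⟩ := hK.elim_nhds_subcover _ fun u hu => hC u hu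
  refine ⟨∑ u ∈ t, |C u|, Finset.sum_nonneg fun _ _ => abs_nonneg _, fun v hv => ?_⟩
  obtain ⟨u, hut, huv⟩ := Set.mem_iUnion₂.1 (hcover hv)
  have huv' : ‖A v‖ ≤ C u * ‖Q v‖ := by simpa using huv
  refine huv'.trans ?_
  refine mul_le_mul_of_nonneg_right ((le_abs_self _).trans ?_) (norm_nonneg _)
  exact Finset.single_le_sum (f := fun u => |C u|) (fun _ _ => abs_nonneg _) hut

/-! ### Admissible weights -/

/-- The weights `p_j` with `j ≥ 2`, extended by zero to `j = 0, 1`. -/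
def backWeight {m : ℕ} (p : Fin (m + 1) → ℝ) (j : Fin (m + 1)) : ℝ :=
  if 2 ≤ (j : ℕ) then p j else 0

namespace IsAdmissible

variable {m : ℕ} {p : Fin (m + 1) → ℝ}

lemma backWeight_nonneg (hp : IsAdmissible p) (j : Fin (m + 1)) : 0 ≤ backWeight p j := by
  unfold backWeight; split_ifs
  exacts [hp.nonneg j, le_rfl]

/-- Separates the term `j = 0`; the term `j = 1` vanishes as `p₁ = 0`. -/
lemma sum_eq (hp : IsAdmissible p) (F : Fin (m + 1) → ℂ) :
    ∑ j, (p j : ℂ) * F j = p 0 * F 0 + ∑ j, (backWeight p j : ℂ) * F j := by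
  have h : ∀ j, (p j : ℂ) * F j
      = (if j = 0 then (p 0 : ℂ) * F 0 else 0) + (backWeight p j : ℂ) * F j := by
    intro j
    unfold backWeight
    rcases eq_or_ne j 0 with rfl | h0
    · simp
    · have : (j : ℕ) ≠ 0 := fun h => h0 (Fin.ext h)
      by_cases h2 : 2 ≤ (j : ℕ)
      · simp [h0, h2]
      · simp [h0, hp.one_eq_zero j (by omega)]
  rw [Finset.sum_congr rfl fun j _ => h j, Finset.sum_add_distrib]
  simp

/-- The mean zero condition: the expected backward displacement equals `p₀`. The truncated
subtraction `j - 1` at `j = 0` is harmless since the weight there is zero. -/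
lemma sum_backWeight_mul (hp : IsAdmissible p) :
    ∑ j, backWeight p j * ((j : ℕ) - 1 : ℕ) = p 0 := by
  have h1 := hp.sum_eq fun j => 1 - ((j : ℕ) : ℂ)
  have h2 : ∑ j, (p j : ℂ) * (1 - ((j : ℕ) : ℂ)) = 0 := by
    have := hp.mean_zero
    rw [← Complex.ofReal_zero, ← this]
    push_cast
    exact Finset.sum_congr rfl fun j _ => mul_comm _ _
  have h3 : ∑ j, (backWeight p j : ℂ) * (1 - ((j : ℕ) : ℂ))
      = -((∑ j, backWeight p j * ((j : ℕ) - 1 : ℕ) : ℝ) : ℂ) := by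
    push_cast
    rw [← Finset.sum_neg_distrib]
    refine Finset.sum_congr rfl fun j _ => ?_
    unfold backWeight
    split_ifs with h
    · rw [Nat.cast_sub (by omega)]; push_cast; ring
    · simp
  rw [h2, h3] at h1
  have h4 : ((∑ j, backWeight p j * ((j : ℕ) - 1 : ℕ) : ℝ) : ℂ) = p 0 := by
    simp only [Fin.val_zero, Nat.cast_zero, sub_zero, mul_one] at h1
    linear_combination h1
  exact_mod_cast h4

lemma two_le (hp : IsAdmissible p) : 2 ≤ m := by
  by_contra h
  have := hp.sum_backWeight_mul
  rw [Finset.sum_eq_zero] at this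
  · exact hp.zero_pos.ne this
  · intro j _
    have := j.2
    simp [backWeight, show ¬ 2 ≤ (j : ℕ) by omega]

lemma p_one (hp : IsAdmissible p) : p 1 = 0 := by
  have := hp.two_le
  refine hp.one_eq_zero 1 ?_
  rw [Fin.val_one', Nat.mod_eq_of_lt (by omega)]

end IsAdmissible

variable {m : ℕ} {p : Fin (m + 1) → ℝ}

/-! ### The polynomials on the curve -/

lemma P_of_lt {k : ℕ} (hk : k < m) : P p k = X ^ k := by
  cases k with
  | zero => simp [P]
  | succ k => rw [P, if_pos hk]

lemma eval_P_succ (hp : IsAdmissible p) {k : ℕ} (hk : m ≤ k + 1) (z : ℂ) :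
    (p 0 : ℂ) * (P p (k + 1)).eval z
      = z * (P p k).eval z
        - ∑ j : Fin (m + 1), (backWeight p j : ℂ) * (P p (k + 1 - (j : ℕ))).eval z := by
  have h0 : (p 0 : ℂ) ≠ 0 := by exact_mod_cast hp.zero_pos.ne'
  rw [P, if_neg (by omega), eval_sub, eval_finsetSum, mul_sub, Finset.mul_sum]
  congr 1
  · simp [hp.p_one]
    field_simp
  · refine Finset.sum_congr rfl fun j _ => ?_
    unfold backWeight
    split_ifs
    · simp; field_simp
    · simp

lemma natDegree_P_le (k : ℕ) : (P p k).natDegree ≤ k := by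
  induction k using Nat.strong_induction_on with
  | _ k ih =>
    cases k with
    | zero => simp [P]
    | succ k =>
      rw [P]
      split_ifs with h
      · simp
      · refine (natDegree_sub_le_of_le (m := k + 1) (n := k + 1) ?_ ?_).trans (max_self _).le
        · refine natDegree_mul_le.trans ?_
          refine (add_le_add (natDegree_C_mul_le _ _) (ih k (by omega))).trans ?_
          rw [natDegree_X_sub_C]; omega
        · refine natDegree_sum_le_of_forall_le _ _ fun j _ => ?_
          split_ifs with hj
          · exact (natDegree_C_mul_le _ _).trans ((ih _ (by omega)).trans (by omega))
          · simp

/-- With `u = e^{-it}`, the point `z = z(t)` of the curve satisfies `u z = ∑ p_j u ^ j`. -/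
lemma inv_mul_curve (hp : IsAdmissible p) (t : ℝ) :
    Complex.exp (-(Complex.I * t)) * curve p t
      = p 0 + ∑ j : Fin (m + 1), (backWeight p j : ℂ) * Complex.exp (-(Complex.I * t)) ^ (j : ℕ) := by
  have := hp.sum_eq fun j => Complex.exp (-(Complex.I * t)) ^ (j : ℕ)
  simp only [Fin.val_zero, pow_zero, mul_one] at this
  rw [← this, curve, Finset.mul_sum]
  refine Finset.sum_congr rfl fun j _ => ?_
  rw [mul_left_comm, ← Complex.exp_add, ← Complex.exp_nat_mul]
  congr 2
  ring

lemma norm_curve_le (hp : IsAdmissible p) (t : ℝ) : ‖curve p t‖ ≤ 1 := by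
  rw [← hp.sum_eq_one]
  refine norm_sum_le_of_le _ fun j _ => ?_
  rw [norm_mul, Complex.norm_real, Real.norm_of_nonneg (hp.nonneg j), Complex.norm_exp]
  simp

/-- With `u = e^{-it}` and `z = z(t)`, the left side is `|u z - 1|`, the size of the increments of
`u ^ k * P_k(z)`. The sum on the right is the factor that degenerates where the recurrence for
`P_k(z)` has a double root. On the unit circle that sum vanishes only if `u ^ j = 1` for all `j ≥ 2`
with `p_j > 0`, where the left side vanishes too and the zero of the right side is simple. -/
lemma exists_norm_sum_pow_sub_one_le (hp : IsAdmissible p) :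
    ∃ C : ℝ, 0 ≤ C ∧ ∀ u : ℂ, ‖u‖ = 1 →
      ‖∑ j : Fin (m + 1), (backWeight p j : ℂ) * (u ^ (j : ℕ) - 1)‖
        ≤ C * ‖∑ j : Fin (m + 1),
          (backWeight p j : ℂ) * ((j : ℕ) - 1 : ℕ) * (1 - u ^ (j : ℕ))‖ := by
  set A : ℂ → ℂ := fun u => ∑ j : Fin (m + 1), (backWeight p j : ℂ) * (u ^ (j : ℕ) - 1)
  set Q : ℂ → ℂ := fun u => ∑ j : Fin (m + 1),
    (backWeight p j : ℂ) * ((j : ℕ) - 1 : ℕ) * (1 - u ^ (j : ℕ))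
  suffices hz : ∀ u ∈ Metric.sphere (0 : ℂ) 1, Q u = 0 → A u = 0 ∧ deriv Q u ≠ 0 by
    obtain ⟨C, hC, h⟩ := exists_norm_le_mul_norm_of_simple_zeros (isCompact_sphere (0 : ℂ) 1)
      (by fun_prop : Differentiable ℂ A) (by fun_prop : Differentiable ℂ Q) hz
    exact ⟨C, hC, fun u hu => h u (by simpa using hu)⟩
  intro u hu hQ
  have hu : ‖u‖ = 1 := by simpa using hu
  have hre : ∀ j : Fin (m + 1), (u ^ (j : ℕ)).re ≤ 1 := fun j =>
    (Complex.re_le_norm _).trans (by rw [norm_pow, hu, one_pow])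
  have hnn : ∀ j : Fin (m + 1), 0 ≤ backWeight p j * ((j : ℕ) - 1 : ℕ) :=
    fun j => mul_nonneg (hp.backWeight_nonneg j) (Nat.cast_nonneg _)
  -- At a zero of `Q` all terms of its real part, being nonnegative, vanish.
  have hterm : ∀ j : Fin (m + 1), backWeight p j ≠ 0 → u ^ (j : ℕ) = 1 := by
    have h0 : ∑ j : Fin (m + 1),
        backWeight p j * ((j : ℕ) - 1 : ℕ) * (1 - (u ^ (j : ℕ)).re) = 0 := by
      have := congrArg Complex.re hQ
      rw [Complex.re_sum, Complex.zero_re] at this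
      rw [← this]
      refine Finset.sum_congr rfl fun j _ => ?_
      rw [← Complex.ofReal_natCast, ← Complex.ofReal_mul, Complex.re_ofReal_mul]
      simp
    intro j hj
    have hj2 : 2 ≤ (j : ℕ) := by
      by_contra h
      exact hj (if_neg h)
    have h1 := (Finset.sum_eq_zero_iff_of_nonneg fun j _ =>
      mul_nonneg (hnn j) (sub_nonneg.2 (hre j))).1 h0 j (Finset.mem_univ j)
    have h2 : (((j : ℕ) - 1 : ℕ) : ℝ) ≠ 0 := by
      exact_mod_cast (by omega : (j : ℕ) - 1 ≠ 0)
    have h3 : (u ^ (j : ℕ)).re = 1 := by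
      have := (mul_eq_zero.1 h1).resolve_left (mul_ne_zero hj h2)
      linarith
    have h4 : ‖u ^ (j : ℕ)‖ = 1 := by rw [norm_pow, hu, one_pow]
    have h5 := Complex.sq_norm_sub_sq_re (u ^ (j : ℕ))
    rw [h3, h4] at h5
    apply Complex.ext
    · simpa using h3
    · have : (u ^ (j : ℕ)).im ^ 2 = 0 := by linarith
      simpa using this
  -- At a zero of `Q`, `-u * Q' u = ∑ q_j (j - 1) j ≥ ∑ q_j (j - 1) = p₀ > 0`.
  refine ⟨Finset.sum_eq_zero fun j _ => ?_, fun hd => ?_⟩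
  · by_cases h : backWeight p j = 0
    · simp [h]
    · simp [hterm j h]
  · have hderiv : HasDerivAt (fun u : ℂ => ∑ j : Fin (m + 1),
        (backWeight p j : ℂ) * ((j : ℕ) - 1 : ℕ) * (1 - u ^ (j : ℕ)))
        (∑ j : Fin (m + 1), (backWeight p j : ℂ) * ((j : ℕ) - 1 : ℕ) *
          (-((j : ℕ) * u ^ ((j : ℕ) - 1)))) u :=
      HasDerivAt.fun_sum fun j _ => ((hasDerivAt_pow (j : ℕ) u).const_sub 1).const_mul _
    rw [hderiv.deriv] at hd
    have h1 : ((∑ j : Fin (m + 1), backWeight p j * ((j : ℕ) - 1 : ℕ) * (j : ℕ) : ℝ) : ℂ) = 0 := by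
      have : (-u) * ∑ j : Fin (m + 1), (backWeight p j : ℂ) * ((j : ℕ) - 1 : ℕ) *
          (-((j : ℕ) * u ^ ((j : ℕ) - 1))) = 0 := by rw [hd, mul_zero]
      rw [← this, Finset.mul_sum]
      push_cast
      refine Finset.sum_congr rfl fun j _ => ?_
      by_cases h : backWeight p j = 0
      · simp [h]
      · have hj2 : (j : ℕ) ≠ 0 := by
          intro h'
          exact h (if_neg (by omega))
        have h6 : u * u ^ ((j : ℕ) - 1) = 1 := by rw [mul_pow_sub_one hj2, hterm j h]
        linear_combination (-(backWeight p j : ℂ) * ((j : ℕ) - 1 : ℕ) * (j : ℕ)) * h6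
    have h2 : p 0 ≤ ∑ j : Fin (m + 1), backWeight p j * ((j : ℕ) - 1 : ℕ) * (j : ℕ) := by
      rw [← hp.sum_backWeight_mul]
      refine Finset.sum_le_sum fun j _ => ?_
      by_cases h : (j : ℕ) = 0
      · simp [h]
      · exact le_mul_of_one_le_right (hnn j) (by exact_mod_cast Nat.one_le_iff_ne_zero.2 h)
    rw [Complex.ofReal_eq_zero.1 h1] at h2
    exact absurd h2 (not_le.2 hp.zero_pos)

/-- The polynomials `P_k` are bounded on the curve `γ`, uniformly in `k`. -/
lemma exists_norm_eval_P_curve_le (hp : IsAdmissible p) :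
    ∃ B : ℝ, 0 ≤ B ∧ ∀ (t : ℝ) (k : ℕ), ‖(P p k).eval (curve p t)‖ ≤ B := by
  obtain ⟨C, hC, hAQ⟩ := exists_norm_sum_pow_sub_one_le hp
  have hp0 := hp.zero_pos
  refine ⟨2 * (p 0 * m * C) + 1, by positivity, fun t k => ?_⟩
  have hm := hp.two_le
  set z := curve p t with hz
  have hz1 : ‖z‖ ≤ 1 := norm_curve_le hp t
  set u := Complex.exp (-(Complex.I * t)) with hu_def
  have hu : ‖u‖ = 1 := by rw [hu_def, Complex.norm_exp]; simp
  have huz : u * z = p 0 + ∑ j : Fin (m + 1), (backWeight p j : ℂ) * u ^ (j : ℕ) :=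
    inv_mul_curve hp t
  have huz1 : u * z - 1 = ∑ j : Fin (m + 1), (backWeight p j : ℂ) * (u ^ (j : ℕ) - 1) := by
    have h1 := hp.sum_eq fun _ => 1
    have h2 : ∑ j, (p j : ℂ) = 1 := by exact_mod_cast congrArg (Complex.ofReal) hp.sum_eq_one
    simp only [mul_one, h2] at h1
    simp only [mul_sub, mul_one, Finset.sum_sub_distrib]
    rw [huz]
    linear_combination -h1
  -- The factor `u ^ k` removes the oscillating solution `e^{ikt}` of the recurrence.
  set S : ℕ → ℂ := fun k => u ^ k * (P p k).eval z with hS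
  have hnorm : ∀ k, ‖S k‖ = ‖(P p k).eval z‖ := fun k => by
    simp only [hS]; rw [norm_mul, norm_pow, hu, one_pow, one_mul]
  have hsmall : ∀ k, k < m → ‖S k‖ ≤ 1 := fun k hk => by
    rw [hnorm, P_of_lt hk, eval_pow, eval_X, norm_pow]
    exact pow_le_one₀ (norm_nonneg _) hz1
  have hinit : ∀ k, k + 1 < m → ‖S (k + 1) - S k‖ ≤ ‖u * z - 1‖ := by
    intro k hk
    have : S (k + 1) - S k = (u * z) ^ k * (u * z - 1) := by
      simp only [hS]
      rw [P_of_lt hk, P_of_lt (by omega), eval_pow, eval_X, eval_pow, eval_X]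
      ring
    rw [this, norm_mul, norm_pow, norm_mul, hu, one_mul]
    exact mul_le_of_le_one_left (norm_nonneg _) (pow_le_one₀ (norm_nonneg _) hz1)
  have hrec : ∀ k, m ≤ k + 1 → (p 0 : ℂ) * (S (k + 1) - S k)
      = ∑ j : Fin (m + 1),
        (backWeight p j : ℂ) * u ^ (j : ℕ) * (S k - S (k - ((j : ℕ) - 1))) := by
    intro k hk
    have h1 := eval_P_succ hp hk z
    have h2 : ∑ j : Fin (m + 1), (backWeight p j : ℂ) * u ^ (j : ℕ) * S (k - ((j : ℕ) - 1))
        = u ^ (k + 1) * ∑ j : Fin (m + 1),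
          (backWeight p j : ℂ) * (P p (k + 1 - (j : ℕ))).eval z := by
      rw [Finset.mul_sum]
      refine Finset.sum_congr rfl fun j _ => ?_
      have hj := j.2
      by_cases h : 2 ≤ (j : ℕ)
      · simp only [hS]
        rw [show k - ((j : ℕ) - 1) = k + 1 - (j : ℕ) by omega]
        have h3 : u ^ (k + 1) = u ^ (j : ℕ) * u ^ (k + 1 - (j : ℕ)) := by
          rw [← pow_add]; congr 1; omega
        rw [h3]; ring
      · simp [backWeight, h]
    simp only [mul_sub, Finset.sum_sub_distrib]
    rw [h2, ← Finset.sum_mul]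
    simp only [hS]
    linear_combination u ^ (k + 1) * h1 + u ^ k * (P p k).eval z * huz
  have hinc := norm_increment_le hp.backWeight_nonneg hp0 hp.sum_backWeight_mul hu hinit hrec
  rw [← hnorm]
  have hpos : 0 ≤ 2 * (p 0 * m * C) := by positivity
  rcases lt_or_ge k m with hk | hk
  · exact (hsmall k hk).trans (by linarith)
  have hmain := norm_mul_sub_le hp.backWeight_nonneg hp.sum_backWeight_mul hu (norm_nonneg _)
    hinc hrec k (by omega)
  have hA := hAQ u hu
  rw [← huz1] at hA
  set Q := ∑ j : Fin (m + 1), (backWeight p j : ℂ) * ((j : ℕ) - 1 : ℕ) * (1 - u ^ (j : ℕ))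
  have hdiff : ‖S k - S (m - 1)‖ ≤ 2 * (p 0 * m * C) := by
    -- If `Q = 0` the increments vanish and `S` is constant; otherwise divide by `Q`.
    rcases eq_or_ne Q 0 with h0 | h0
    · have h1 := norm_sub_le_of_increment_le hinc (m - 1) (k - (m - 1))
      rw [h0, norm_zero, mul_zero] at hA
      rw [le_antisymm hA (norm_nonneg _), mul_zero, Nat.add_sub_cancel' (by omega)] at h1
      exact h1.trans hpos
    · refine le_of_mul_le_mul_left (hmain.trans ?_) (norm_pos_iff.2 h0)
      calc 2 * (p 0 * m * ‖u * z - 1‖) ≤ 2 * (p 0 * m * (C * ‖Q‖)) := by gcongr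
        _ = _ := by ring
  calc ‖S k‖ = ‖(S k - S (m - 1)) + S (m - 1)‖ := by rw [sub_add_cancel]
    _ ≤ _ := (norm_add_le _ _).trans (add_le_add hdiff (hsmall _ (by omega)))

/-! ### The maximum principle on the enclosed region -/

/-- Maximum principle: a polynomial bounded on `γ` has the same bound on `Γ`, since the frontier of
a component of the complement of `γ` lies in `γ`. -/
lemma norm_eval_le_of_mem_region {F : ℂ[X]} {B : ℝ}
    (hF : ∀ t : ℝ, ‖F.eval (curve p t)‖ ≤ B) {z : ℂ} (hz : z ∈ region p) : ‖F.eval z‖ ≤ B := by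
  have hcompact : IsCompact (gammaCurve p) :=
    isCompact_Icc.image (by unfold curve; fun_prop)
  have hγ : ∀ z ∈ gammaCurve p, ‖F.eval z‖ ≤ B := by
    rintro _ ⟨t, -, rfl⟩
    exact hF t
  have hclosed : IsClosed {z : ℂ | ‖F.eval z‖ ≤ B} :=
    isClosed_le F.continuous.norm continuous_const
  refine closure_minimal (t := {z : ℂ | ‖F.eval z‖ ≤ B}) ?_ hclosed hz
  rintro z (h | ⟨hz, hb⟩)
  · exact hγ z h
  · have hopen : IsOpen (gammaCurve p)ᶜ := hcompact.isClosed.isOpen_compl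
    refine Complex.norm_le_of_forall_mem_frontier_norm_le hb
      F.differentiable.diffContOnCl (fun v hv => ?_) (subset_closure (mem_connectedComponentIn hz))
    refine hγ v ?_
    by_contra hvγ
    have hvo : IsOpen (connectedComponentIn (gammaCurve p)ᶜ v) := hopen.connectedComponentIn
    -- Otherwise the component of `v` meets that of `z`, so `v` is interior to the latter.
    obtain ⟨x, hx1, hx2⟩ := mem_closure_iff.1 hv.1 _ hvo (mem_connectedComponentIn hvγ)
    have heq := (connectedComponentIn_eq hx1).trans (connectedComponentIn_eq hx2).symm
    refine hv.2 ?_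
    rw [hopen.connectedComponentIn.interior_eq, ← heq]
    exact mem_connectedComponentIn hvγ

/-! ### One step of the walk -/

lemma stepNat_of_lt (hp : IsAdmissible p) {k : ℕ} (hk : k + 1 < m) :
    stepNat p hp k = (flipLaw k).map fun b => if b then (k : ℤ) + 1 else -((k : ℤ) + 1) :=
  if_pos hk

lemma stepNat_of_le (hp : IsAdmissible p) {k : ℕ} (hk : m ≤ k + 1) :
    stepNat p hp k = (indexLaw p hp).map fun j : Fin (m + 1) => (k : ℤ) + 1 - ((j : ℕ) : ℤ) := by
  rw [stepNat, if_neg (by omega)]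
  -- In `stepNat` the index law is first pushed forward to `ℕ`, by a monadic coercion.
  change PMF.map _ ((indexLaw p hp).bind (PMF.pure ∘ _)) = _
  rw [PMF.bind_pure_comp, PMF.map_comp]
  rfl

section Step

variable {E : Type*} [NormedAddCommGroup E] [NormedSpace ℝ E]

lemma integral_stepNat_of_lt [CompleteSpace E] (hp : IsAdmissible p) {k : ℕ} (hk : k + 1 < m)
    (f : ℤ → E) :
    ∫ i, f i ∂(stepNat p hp k).toMeasure
      = ((2 * (k : ℝ) + 1) / (2 * k + 2)) • f (k + 1)
        + (1 / (2 * (k : ℝ) + 2)) • f (-(k + 1)) := by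
  rw [stepNat_of_lt hp hk, ← PMF.toMeasure_map _ _ Measurable.of_discrete,
    integral_map Measurable.of_discrete.aemeasurable
      StronglyMeasurable.of_discrete.aestronglyMeasurable, PMF.integral_eq_sum]
  have h1 : (0 : ℝ) ≤ (2 * (k : ℝ) + 1) / (2 * k + 2) := by positivity
  have h2 : (0 : ℝ) ≤ 1 / (2 * (k : ℝ) + 2) := by positivity
  simp only [Fintype.sum_bool, flipLaw, PMF.ofFintype_apply, if_true, Bool.false_eq_true, if_false,
    ENNReal.toReal_ofReal h1, ENNReal.toReal_ofReal h2]

lemma integral_stepNat_of_le [CompleteSpace E] (hp : IsAdmissible p) {k : ℕ} (hk : m ≤ k + 1)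
    (f : ℤ → E) :
    ∫ i, f i ∂(stepNat p hp k).toMeasure = ∑ j : Fin (m + 1), p j • f (k + 1 - (j : ℕ)) := by
  rw [stepNat_of_le hp hk, ← PMF.toMeasure_map _ _ Measurable.of_discrete,
    integral_map Measurable.of_discrete.aemeasurable
      StronglyMeasurable.of_discrete.aestronglyMeasurable, PMF.integral_eq_sum]
  simp only [indexLaw, PMF.ofFintype_apply, ENNReal.toReal_ofReal (hp.nonneg _)]

lemma integral_step_of_neg (hp : IsAdmissible p) {k : ℤ} (hk : k < 0) (f : ℤ → E) :
    ∫ i, f i ∂(step p hp k).toMeasure = ∫ i, f (-i) ∂(stepNat p hp (-k).toNat).toMeasure := by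
  rw [step, if_neg (by omega), ← PMF.toMeasure_map _ _ Measurable.of_discrete,
    integral_map Measurable.of_discrete.aemeasurable
      StronglyMeasurable.of_discrete.aestronglyMeasurable]

end Step

lemma ae_stepNat_abs_sub_le (hp : IsAdmissible p) (k : ℕ) :
    ∀ᵐ i ∂(stepNat p hp k).toMeasure, |i - (k : ℤ)| ≤ 2 * m := by
  rcases lt_or_ge (k + 1) m with hk | hk
  · rw [stepNat_of_lt hp hk, ← PMF.toMeasure_map _ _ Measurable.of_discrete,
      ae_map_iff Measurable.of_discrete.aemeasurable (Set.to_countable _).measurableSet]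
    refine Filter.Eventually.of_forall fun b => ?_
    cases b
    · change |-((k : ℤ) + 1) - k| ≤ 2 * m
      rw [abs_le]; omega
    · change |(k : ℤ) + 1 - k| ≤ 2 * m
      rw [abs_le]; omega
  · rw [stepNat_of_le hp hk, ← PMF.toMeasure_map _ _ Measurable.of_discrete,
      ae_map_iff Measurable.of_discrete.aemeasurable (Set.to_countable _).measurableSet]
    refine Filter.Eventually.of_forall fun j => ?_
    have := j.2
    have := hp.two_le
    rw [abs_le]; omega

lemma ae_step_abs_sub_le (hp : IsAdmissible p) (k : ℤ) :
    ∀ᵐ i ∂(step p hp k).toMeasure, |i - k| ≤ 2 * m := by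
  rw [step]
  split_ifs with hk
  · filter_upwards [ae_stepNat_abs_sub_le hp k.toNat] with i hi
    rwa [Int.toNat_of_nonneg hk] at hi
  · rw [← PMF.toMeasure_map _ _ Measurable.of_discrete,
      ae_map_iff Measurable.of_discrete.aemeasurable (Set.to_countable _).measurableSet]
    filter_upwards [ae_stepNat_abs_sub_le hp (-k).toNat] with i hi
    rw [Int.toNat_of_nonneg (by omega)] at hi
    rwa [← abs_neg, show -(-i - k) = i - -k by ring]

lemma integral_stepNat_id (hp : IsAdmissible p) (k : ℕ) :
    ∫ i, (i : ℝ) ∂(stepNat p hp k).toMeasure = k := by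
  rcases lt_or_ge (k + 1) m with hk | hk
  · rw [integral_stepNat_of_lt hp hk]
    push_cast
    simp only [smul_eq_mul]
    field_simp
    ring
  · rw [integral_stepNat_of_le hp hk]
    have h1 : ∀ j : Fin (m + 1), p j • (((k : ℤ) + 1 - ((j : ℕ) : ℤ) : ℤ) : ℝ)
        = k * p j + (1 - (j : ℝ)) * p j := fun j => by
      push_cast; rw [smul_eq_mul]; ring
    rw [Finset.sum_congr rfl fun j _ => h1 j, Finset.sum_add_distrib, ← Finset.mul_sum,
      hp.sum_eq_one, hp.mean_zero]
    ring

/-- The walk is a martingale. -/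
lemma integral_step_id (hp : IsAdmissible p) (k : ℤ) :
    ∫ i, (i : ℝ) ∂(step p hp k).toMeasure = k := by
  rcases lt_or_ge k 0 with hk | hk
  · rw [integral_step_of_neg hp hk]
    push_cast
    rw [integral_neg, integral_stepNat_id, ← Int.cast_natCast, Int.toNat_of_nonneg (by omega)]
    push_cast; ring
  · rw [step, if_pos hk, integral_stepNat_id, ← Int.cast_natCast, Int.toNat_of_nonneg hk]

lemma integral_stepNat_eval_P (hp : IsAdmissible p) (z : ℂ) (k : ℕ) :
    ∫ i, (P p i.natAbs).eval z ∂(stepNat p hp k).toMeasure = z * (P p k).eval z := by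
  rcases lt_or_ge (k + 1) m with hk | hk
  · rw [integral_stepNat_of_lt hp hk, Int.natAbs_neg, ← add_smul, ← add_div]
    have h1 : ((k : ℤ) + 1).natAbs = k + 1 := by omega
    have h2 : (2 * (k : ℝ) + 1 + 1) / (2 * k + 2) = 1 := by field_simp; ring
    rw [h1, h2, one_smul, P_of_lt hk, P_of_lt (by omega), eval_pow, eval_pow, eval_X, pow_succ']
  · rw [integral_stepNat_of_le hp hk]
    have h1 : ∀ j : Fin (m + 1), p j • (P p ((k : ℤ) + 1 - ((j : ℕ) : ℤ)).natAbs).eval z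
        = (p j : ℂ) * (P p (k + 1 - (j : ℕ))).eval z := fun j => by
      have := j.2
      rw [Complex.real_smul, show ((k : ℤ) + 1 - ((j : ℕ) : ℤ)).natAbs = k + 1 - (j : ℕ) by omega]
    rw [Finset.sum_congr rfl fun j _ => h1 j, hp.sum_eq fun j => (P p (k + 1 - (j : ℕ))).eval z]
    have := eval_P_succ hp hk z
    simp only [Fin.val_zero, Nat.sub_zero]
    linear_combination this

/-- The function `k ↦ P_{|k|}(z)` is an eigenfunction of the walk, with eigenvalue `z`. -/
lemma integral_step_eval_P (hp : IsAdmissible p) (z : ℂ) (k : ℤ) :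
    ∫ i, (P p i.natAbs).eval z ∂(step p hp k).toMeasure = z * (P p k.natAbs).eval z := by
  rcases lt_or_ge k 0 with hk | hk
  · rw [integral_step_of_neg hp hk]
    simp only [Int.natAbs_neg]
    rw [integral_stepNat_eval_P, show (-k).toNat = k.natAbs by omega]
  · rw [step, if_pos hk, integral_stepNat_eval_P, show k.toNat = k.natAbs by omega]

/-- Hoeffding's lemma for one step: increments are centred and bounded by `2 m`. -/
lemma integral_step_exp_le (hp : IsAdmissible p) (k : ℤ) (t : ℝ) :
    ∫ i, Real.exp (t * i) ∂(step p hp k).toMeasure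
      ≤ Real.exp (2 * m ^ 2 * t ^ 2) * Real.exp (t * k) := by
  have hb : ∀ᵐ (i : ℤ) ∂(step p hp k).toMeasure,
      (i : ℝ) ∈ Set.Icc ((k : ℝ) - 2 * m) ((k : ℝ) + 2 * m) := by
    filter_upwards [ae_step_abs_sub_le hp k] with i hi
    have h : |(i : ℝ) - k| ≤ 2 * m := by exact_mod_cast hi
    rw [abs_le] at h
    constructor <;> linarith
  have h := (hasSubgaussianMGF_of_mem_Icc (X := fun i : ℤ => (i : ℝ))
    Measurable.of_discrete.aemeasurable hb).mgf_le t
  rw [integral_step_id] at h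
  have hexp : ∀ i : ℤ, Real.exp (t * i) = Real.exp (t * (i - k)) * Real.exp (t * k) := fun i => by
    rw [← Real.exp_add]; ring_nf
  rw [integral_congr_ae (Filter.Eventually.of_forall hexp), integral_mul_const]
  refine mul_le_mul_of_nonneg_right (h.trans (Real.exp_le_exp.2 (le_of_eq ?_))) (Real.exp_nonneg _)
  push_cast
  rw [show (k : ℝ) + 2 * m - (k - 2 * m) = 4 * m by ring, Real.norm_of_nonneg (by positivity)]
  ring

/-! ### Law and tails of the walk -/

instance (hp : IsAdmissible p) : IsProbabilityMeasure (walkMeasure p hp) := by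
  unfold walkMeasure; infer_instance

lemma measurable_Y (n : ℕ) : Measurable (Y n) := measurable_pi_apply n

lemma ae_Y_zero (hp : IsAdmissible p) : ∀ᵐ ω ∂walkMeasure p hp, Y 0 ω = 0 := by
  have h : (walkMeasure p hp).map (Preorder.frestrictLe 0)
      = (Measure.dirac (0 : ℤ)).map
        (MeasurableEquiv.piUnique fun _ : Finset.Iic 0 => ℤ).symm := by
    rw [walkMeasure, Kernel.trajMeasure, Measure.map_comp _ _ (by fun_prop),
      Kernel.traj_map_frestrictLe, Kernel.partialTraj_self, Measure.id_comp]
  rw [Measure.map_dirac' (MeasurableEquiv.measurable _)] at h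
  have h0 : ∀ᵐ x ∂(walkMeasure p hp).map (Preorder.frestrictLe (π := fun _ => ℤ) 0),
      x ⟨0, Finset.mem_Iic.2 le_rfl⟩ = 0 := by
    have hmeas : MeasurableSet {x : Finset.Iic 0 → ℤ | x ⟨0, Finset.mem_Iic.2 le_rfl⟩ = 0} :=
      measurableSet_eq_fun (measurable_pi_apply _) measurable_const
    rw [h, ae_dirac_iff hmeas]
    rfl
  exact ae_of_ae_map (by fun_prop) h0

/-- The joint law of the path up to time `n` and the position at time `n + 1`. -/
lemma map_frestrictLe_compProd (hp : IsAdmissible p) (n : ℕ) :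
    (walkMeasure p hp).map (Preorder.frestrictLe n) ⊗ₘ pastKernel p hp n =
      (walkMeasure p hp).map (fun ω => (Preorder.frestrictLe n ω, ω (n + 1))) :=
  Kernel.map_frestrictLe_trajMeasure_compProd_eq_map_trajMeasure

lemma lintegral_Y_succ (hp : IsAdmissible p) (n : ℕ) (f : ℤ → ENNReal) :
    ∫⁻ ω, f (Y (n + 1) ω) ∂walkMeasure p hp
      = ∫⁻ ω, ∫⁻ i, f i ∂(step p hp (Y n ω)).toMeasure ∂walkMeasure p hp := by
  have h := congrArg (fun ν => ∫⁻ x, f x.2 ∂ν) (map_frestrictLe_compProd hp n)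
  have hf : Measurable f := measurable_of_countable _
  have hf2 : Measurable fun x : (Finset.Iic n → ℤ) × ℤ => f x.2 := hf.comp measurable_snd
  have hs : Measurable fun k : ℤ => ∫⁻ i, f i ∂(step p hp k).toMeasure := Measurable.of_discrete
  have hlast : Measurable fun x : Finset.Iic n → ℤ =>
      ∫⁻ i, f i ∂pastKernel p hp n x := hs.comp (measurable_pi_apply _)
  rw [Measure.lintegral_compProd hf2, lintegral_map hf2 (by fun_prop),
    lintegral_map hlast (by fun_prop)] at h
  exact h.symm

lemma integral_Y_succ (hp : IsAdmissible p) {E : Type*} [NormedAddCommGroup E] [NormedSpace ℝ E]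
    [SecondCountableTopology E]
    (n : ℕ) {f : ℤ → E} (hf : Integrable (fun ω => f (Y (n + 1) ω)) (walkMeasure p hp)) :
    ∫ ω, f (Y (n + 1) ω) ∂walkMeasure p hp
      = ∫ ω, ∫ i, f i ∂(step p hp (Y n ω)).toMeasure ∂walkMeasure p hp := by
  have hfm : StronglyMeasurable f := StronglyMeasurable.of_discrete
  have h := map_frestrictLe_compProd hp n
  have hpair : Measurable fun ω : ℕ → ℤ => (Preorder.frestrictLe (π := fun _ => ℤ) n ω, ω (n + 1)) :=
    by fun_prop
  have hf2 : StronglyMeasurable fun x : (Finset.Iic n → ℤ) × ℤ => f x.2 :=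
    hfm.comp_measurable measurable_snd
  have hint : Integrable (fun x : (Finset.Iic n → ℤ) × ℤ => f x.2)
      ((walkMeasure p hp).map (Preorder.frestrictLe n) ⊗ₘ pastKernel p hp n) := by
    rw [h, integrable_map_measure hf2.aestronglyMeasurable hpair.aemeasurable]
    exact hf
  have h1 := Measure.integral_compProd hint
  rw [h, integral_map hpair.aemeasurable hf2.aestronglyMeasurable] at h1
  refine h1.trans ?_
  rw [integral_map (by fun_prop) ?_]
  · rfl
  · have : Measurable fun x : Finset.Iic n → ℤ => x ⟨n, Finset.mem_Iic.2 le_rfl⟩ := by fun_prop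
    exact ((StronglyMeasurable.of_discrete
      (f := fun k : ℤ => ∫ i, f i ∂(step p hp k).toMeasure)).comp_measurable
        this).aestronglyMeasurable

lemma ae_abs_Y_le (hp : IsAdmissible p) (n : ℕ) :
    ∀ᵐ ω ∂walkMeasure p hp, |Y n ω| ≤ 2 * m * n := by
  induction n with
  | zero => filter_upwards [ae_Y_zero hp] with ω h; simp [h]
  | succ n ih =>
    set f : ℤ → ENNReal := fun i => if |i| ≤ 2 * m * (n + 1 : ℕ) then 0 else 1 with hf
    have hfm : Measurable fun ω : ℕ → ℤ => f (Y (n + 1) ω) :=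
      (measurable_of_countable f).comp (measurable_Y (n + 1))
    have h := lintegral_Y_succ hp n f
    have h0 : ∀ᵐ ω ∂walkMeasure p hp, ∫⁻ i, f i ∂(step p hp (Y n ω)).toMeasure = 0 := by
      filter_upwards [ih] with ω hω
      refine (lintegral_congr_ae ?_).trans lintegral_zero
      filter_upwards [ae_step_abs_sub_le hp (Y n ω)] with i hi
      have := abs_sub_abs_le_abs_sub i (Y n ω)
      exact if_pos (by push_cast; linarith)
    rw [lintegral_congr_ae h0, lintegral_zero, lintegral_eq_zero_iff hfm] at h
    filter_upwards [h] with ω hω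
    by_contra hc
    exact one_ne_zero ((if_neg hc).symm.trans hω)

lemma integrable_comp_Y (hp : IsAdmissible p) {E : Type*} [NormedAddCommGroup E]
    [SecondCountableTopology E] (n : ℕ) (f : ℤ → E) :
    Integrable (fun ω => f (Y n ω)) (walkMeasure p hp) := by
  refine Integrable.of_bound ((StronglyMeasurable.of_discrete (f := f)).comp_measurable
    (measurable_Y n)).aestronglyMeasurable
    (∑ i ∈ Finset.Icc (-(2 * m * n : ℤ)) (2 * m * n), ‖f i‖) ?_
  filter_upwards [ae_abs_Y_le hp n] with ω hω
  exact Finset.single_le_sum (f := fun i => ‖f i‖) (fun _ _ => norm_nonneg _)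
    (Finset.mem_Icc.2 (abs_le.1 hω))

/-- Expansion of `z ^ n`: `𝔼 P_{|Y_n|}(z) = z ^ n`. -/
lemma integral_eval_P_Y (hp : IsAdmissible p) (z : ℂ) (n : ℕ) :
    ∫ ω, (P p (Y n ω).natAbs).eval z ∂walkMeasure p hp = z ^ n := by
  induction n with
  | zero =>
    have : ∀ᵐ ω ∂walkMeasure p hp, (P p (Y 0 ω).natAbs).eval z = 1 := by
      filter_upwards [ae_Y_zero hp] with ω h; simp [h, P]
    rw [integral_congr_ae this]; simp
  | succ n ih =>
    rw [integral_Y_succ hp n (f := fun i => (P p i.natAbs).eval z)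
      (integrable_comp_Y hp (n + 1) fun i => (P p i.natAbs).eval z)]
    simp only [integral_step_eval_P]
    rw [integral_const_mul, ih, pow_succ']

lemma mgf_Y_le (hp : IsAdmissible p) (t : ℝ) (n : ℕ) :
    mgf (fun ω => (Y n ω : ℝ)) (walkMeasure p hp) t ≤ Real.exp (2 * m ^ 2 * t ^ 2 * n) := by
  rw [mgf]
  induction n with
  | zero =>
    have : ∀ᵐ ω ∂walkMeasure p hp, Real.exp (t * Y 0 ω) = 1 := by
      filter_upwards [ae_Y_zero hp] with ω h; simp [h]
    rw [integral_congr_ae this]; simp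
  | succ n ih =>
    rw [integral_Y_succ hp n (f := fun i => Real.exp (t * i))
      (integrable_comp_Y hp (n + 1) fun i => Real.exp (t * i))]
    calc ∫ ω, ∫ i, Real.exp (t * i) ∂(step p hp (Y n ω)).toMeasure ∂walkMeasure p hp
        ≤ ∫ ω, Real.exp (2 * m ^ 2 * t ^ 2) * Real.exp (t * Y n ω) ∂walkMeasure p hp :=
          integral_mono (integrable_comp_Y hp n fun k => ∫ i, Real.exp (t * i) ∂(step p hp k).toMeasure)
            (integrable_comp_Y hp n fun k => Real.exp (2 * m ^ 2 * t ^ 2) * Real.exp (t * k))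
            fun ω => integral_step_exp_le hp _ _
      _ ≤ Real.exp (2 * m ^ 2 * t ^ 2) * Real.exp (2 * m ^ 2 * t ^ 2 * n) := by
          rw [integral_const_mul]
          exact mul_le_mul_of_nonneg_left ih (Real.exp_nonneg _)
      _ = _ := by rw [← Real.exp_add]; push_cast; ring_nf

lemma measureReal_abs_Y_ge_le (hp : IsAdmissible p) {n : ℕ} (hn : n ≠ 0) {s : ℝ} (hs : 0 ≤ s) :
    (walkMeasure p hp).real {ω | s ≤ |(Y n ω : ℝ)|} ≤ 2 * Real.exp (-s ^ 2 / (8 * m ^ 2 * n)) := by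
  have hm : (0 : ℝ) < m := by exact_mod_cast (by have := hp.two_le; omega : 0 < m)
  have hn' : (0 : ℝ) < n := by exact_mod_cast Nat.pos_of_ne_zero hn
  -- The Chernoff exponent minimizing `-l * s + 2 * m ^ 2 * l ^ 2 * n`.
  set l : ℝ := s / (4 * m ^ 2 * n) with hl
  have hl0 : 0 ≤ l := by positivity
  have hexp : -s ^ 2 / (8 * m ^ 2 * n) = -l * s + 2 * m ^ 2 * l ^ 2 * n := by
    rw [hl]; field_simp; ring
  have h1 := measure_ge_le_exp_mul_mgf (μ := walkMeasure p hp) (X := fun ω => (Y n ω : ℝ)) s hl0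
    (integrable_comp_Y hp n fun i => Real.exp (l * i))
  have h2 := measure_le_le_exp_mul_mgf (μ := walkMeasure p hp) (X := fun ω => (Y n ω : ℝ)) (-s)
    (neg_nonpos.2 hl0) (integrable_comp_Y hp n fun i => Real.exp (-l * i))
  have h1' := h1.trans (mul_le_mul_of_nonneg_left (mgf_Y_le hp l n) (Real.exp_nonneg _))
  have h2' := h2.trans (mul_le_mul_of_nonneg_left (mgf_Y_le hp (-l) n) (Real.exp_nonneg _))
  rw [← Real.exp_add] at h1' h2'
  rw [show - -l * -s + 2 * (m : ℝ) ^ 2 * (-l) ^ 2 * n = -l * s + 2 * m ^ 2 * l ^ 2 * n by ring]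
    at h2'
  rw [hexp, two_mul]
  refine (measureReal_mono (s₂ := {ω | s ≤ (Y n ω : ℝ)} ∪ {ω | (Y n ω : ℝ) ≤ -s}) ?_).trans
    ((measureReal_union_le _ _).trans (add_le_add h1' h2'))
  intro ω hω
  rcases le_abs.1 (show s ≤ |(Y n ω : ℝ)| from hω) with h | h
  · exact Or.inl h
  · exact Or.inr (show (Y n ω : ℝ) ≤ -s by linarith)

/-! ### The truncation error -/

lemma eval_approx (hp : IsAdmissible p) (n : ℕ) (t : ℝ) (z : ℂ) :
    (approx p hp n t).eval z = ∫ ω, {ω | (Y n ω).natAbs ≤ ⌊t * Real.sqrt n⌋₊}.indicator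
      (fun ω => (P p (Y n ω).natAbs).eval z) ω ∂walkMeasure p hp := by
  set N := ⌊t * Real.sqrt n⌋₊
  have hmeas : ∀ k : ℕ, MeasurableSet {ω : ℕ → ℤ | |Y n ω| = (k : ℤ)} := fun k =>
    measurable_Y n (Set.to_countable {i : ℤ | |i| = (k : ℤ)}).measurableSet
  have h : ∀ ω, {ω | (Y n ω).natAbs ≤ N}.indicator (fun ω => (P p (Y n ω).natAbs).eval z) ω
      = ∑ k ∈ Finset.range (N + 1),
        {ω : ℕ → ℤ | |Y n ω| = (k : ℤ)}.indicator (fun _ => (P p k).eval z) ω := by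
    intro ω
    simp only [Set.indicator_apply, Set.mem_ofPred_eq, Int.abs_eq_natAbs, Nat.cast_inj]
    rw [Finset.sum_ite_eq]
    simp
  simp only [h]
  rw [integral_finsetSum _ fun k _ => (integrable_const _).indicator (hmeas k), approx,
    eval_finsetSum]
  refine Finset.sum_congr rfl fun k _ => ?_
  rw [integral_indicator_const _ (hmeas k), eval_mul, eval_C, Complex.real_smul]
  rfl

/-- Truncation drops the part of `𝔼 P_{|Y_n|}(z)` where `|Y_n| > ⌊t √n⌋`. -/
lemma norm_eval_approx_sub_pow_le (hp : IsAdmissible p) (n : ℕ) (t : ℝ) {z : ℂ} {B : ℝ}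
    (hB : ∀ k, ‖(P p k).eval z‖ ≤ B) :
    ‖(approx p hp n t).eval z - z ^ n‖
      ≤ B * (walkMeasure p hp).real {ω | ⌊t * Real.sqrt n⌋₊ < (Y n ω).natAbs} := by
  set N := ⌊t * Real.sqrt n⌋₊
  set s := {ω : ℕ → ℤ | (Y n ω).natAbs ≤ N} with hs
  have hsm : MeasurableSet s :=
    measurable_Y n (Set.to_countable {i : ℤ | i.natAbs ≤ N}).measurableSet
  have hint := integrable_comp_Y hp n fun i => (P p i.natAbs).eval z
  rw [eval_approx, ← integral_eval_P_Y hp z n, integral_indicator hsm,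
    ← integral_add_compl hsm hint, sub_add_cancel_left, norm_neg]
  have hc : sᶜ = {ω | N < (Y n ω).natAbs} := by ext ω; simp [hs]
  rw [← hc]
  exact norm_setIntegral_le_of_norm_le_const (measure_lt_top _ _) fun ω _ => hB _

end WalkPoly

theorem theorem1p4 (m : ℕ) (p : Fin (m + 1) → ℝ) (hp : WalkPoly.IsAdmissible p) :
    ∃ C c : ℝ, 0 < C ∧ 0 < c ∧
      ∀ (n : ℕ) (t : ℝ), 0 ≤ t →
        (WalkPoly.approx p hp n t).natDegree ≤ ⌊t * Real.sqrt n⌋₊ ∧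
        ∀ z ∈ WalkPoly.region p,
          ‖(WalkPoly.approx p hp n t).eval z - z ^ n‖ ≤ C * Real.exp (-c * t ^ 2) := by
  obtain ⟨B, hB0, hB⟩ := WalkPoly.exists_norm_eval_P_curve_le hp
  have hm : (0 : ℝ) < m := by exact_mod_cast (by have := hp.two_le; omega : 0 < m)
  refine ⟨2 * B + 1, 1 / (8 * m ^ 2), by positivity, by positivity, fun n t ht => ⟨?_, ?_⟩⟩
  · refine natDegree_sum_le_of_forall_le _ _ fun k hk => (natDegree_C_mul_le _ _).trans ?_
    exact (WalkPoly.natDegree_P_le k).trans (Nat.lt_succ_iff.1 (Finset.mem_range.1 hk))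
  intro z hz
  have hBz : ∀ k, ‖(WalkPoly.P p k).eval z‖ ≤ B := fun k =>
    WalkPoly.norm_eval_le_of_mem_region (fun s => hB s k) hz
  refine (WalkPoly.norm_eval_approx_sub_pow_le hp n t hBz).trans ?_
  rcases eq_or_ne n 0 with rfl | hn
  · have h0 : (WalkPoly.walkMeasure p hp).real
        {ω | ⌊t * Real.sqrt (0 : ℕ)⌋₊ < (WalkPoly.Y 0 ω).natAbs} = 0 := by
      rw [measureReal_def, measure_eq_zero_iff_ae_notMem.2, ENNReal.toReal_zero]
      filter_upwards [WalkPoly.ae_Y_zero hp] with ω h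
      simp [h]
    rw [h0, mul_zero]
    positivity
  · have hn' : (0 : ℝ) < n := by exact_mod_cast Nat.pos_of_ne_zero hn
    have htail := WalkPoly.measureReal_abs_Y_ge_le hp hn
      (mul_nonneg ht (Real.sqrt_nonneg n))
    have hexp : -(t * Real.sqrt n) ^ 2 / (8 * m ^ 2 * n) = -(1 / (8 * m ^ 2)) * t ^ 2 := by
      rw [mul_pow, Real.sq_sqrt hn'.le]; field_simp
    rw [hexp] at htail
    have hsub : (WalkPoly.walkMeasure p hp).real
        {ω | ⌊t * Real.sqrt n⌋₊ < (WalkPoly.Y n ω).natAbs}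
          ≤ 2 * Real.exp (-(1 / (8 * m ^ 2)) * t ^ 2) := by
      refine (measureReal_mono fun ω hω => ?_).trans htail
      have h1 := Nat.lt_of_floor_lt (show _ < (WalkPoly.Y n ω).natAbs from hω)
      rw [Nat.cast_natAbs] at h1
      exact_mod_cast h1.le
    calc _ ≤ B * (2 * Real.exp (-(1 / (8 * m ^ 2)) * t ^ 2)) :=
          mul_le_mul_of_nonneg_left hsub hB0
      _ ≤ _ := by nlinarith [Real.exp_nonneg (-(1 / (8 * (m : ℝ) ^ 2)) * t ^ 2)]
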